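/- Let $\mu$ be the standard Gaussian measure on $\mathbb{R}$ and write $\mu(f)=\int f\,\mathrm{d}\mu$. Let $\ell>0$ and let $\mathcal{H}$ be the reproducing kernel Hilbert space of the Gaussian kernel $k(x,y)=\exp\big(-(x-y)^2/(2\ell^2)\big)$ on $\mathbb{R}$. Put $$\alpha=\tfrac{1}{\sqrt2},\qquad \epsilon=\frac{1}{\sqrt2\,\ell},\qquad \beta=\Big(1+\Big(\frac{2\epsilon}{\alpha}\Big)^2\Big)^{1/4},\qquad \delta^2=\frac{\alpha^2}{2}(\beta^2-1),$$ $$\varphi_n(x)=\sqrt{\frac{\beta}{n!}}\;e^{-\delta^2x^2}\,\mathrm{H}_n\big(\sqrt2\,\alpha\beta x\big)\quad(n\ge 0),\qquad \tau=\sqrt{\frac{\alpha^2}{\alpha^2+\delta^2+\epsilon^2}},\qquad \lambda=\frac{\epsilon^2}{\alpha^2+\delta^2+\epsilon^2},$$ where $\mathrm{H}_n$ is the $n$-th (unnormalised) probabilists' Hermite polynomial; the $\varphi_n$ are the Mercer eigenfunctions of $k$ with respect to $\mu$, with eigenvalues $\tau\lambda^n$. For a quadrature rule $Q(f)=\sum_{n=1}^N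 w_nf(x_n)$ with nodes $x_n\in\mathbb{R}$ and weights $w_n\in\mathbb{R}$, the worst-case error is $e(Q)=\sup_{f\in\mathcal{H},\,\|f\|_{\mathcal{H}}\le1}|\mu(f)-Q(f)|$. **Theorem.** There is an absolute constant $0<K\le 1.087$ such that, for every $\ell>0$, the numbers $$C_1=K\sqrt{\beta},\qquad C_2=\frac{\sqrt{\tau}}{1-\sqrt{\lambda}},\qquad \eta=\sqrt{\lambda}\,e^{1/\beta^2}$$ satisfy $C_1,C_2>0$ and $0<\eta<1$, and the following holds. Let $Q_N(f)=\sum_{n=1}^Nw_nf(x_n)$ be an $N$-point quadrature rule, let $W_N\ge0$ be a real number and $M_N\ge1$ an integer such that 1. $\sum_{n=1}^N|w_n|\le W_N$; 2. $Q_N(\varphi_n)=\mu(\varphi_n)$ for each $n=0,\dots,M_N-1$; 3. $|x_n|\le 2\sqrt{M_N}/\beta$ for each $n=1,\dots,N$. Then $$e(Q_N)\le(1+C_1W_N)\,C_2\,\eta^{M_N}.$$ -/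

import Mathlib

open MeasureTheory ProbabilityTheory
open scoped ENNReal Nat

namespace GaussianQuadrature

noncomputable section

/-- The Gaussian kernel `k(x, y) = exp(-(x - y)² / (2ℓ²))` with length-scale `ℓ`. -/
def gaussianKernel (ℓ x y : ℝ) : ℝ := Real.exp (-(x - y) ^ 2 / (2 * ℓ ^ 2))

/-- The Gaussian kernel in the operator-valued format of Mathlib's `RKHS`: the entry at `(x, y)` is
multiplication by `k(x, y)` on `ℝ`. -/
def gaussianKernelMatrix (ℓ : ℝ) : Matrix ℝ ℝ (ℝ →L[ℝ] ℝ) :=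
  Matrix.of fun x y => gaussianKernel ℓ x y • ContinuousLinearMap.id ℝ ℝ

theorem gaussianKernel_eq (ℓ x y : ℝ) : gaussianKernel ℓ x y =
    Real.exp (-x ^ 2 / (2 * ℓ ^ 2)) * Real.exp (-y ^ 2 / (2 * ℓ ^ 2)) *
      Real.exp ((x / ℓ) * (y / ℓ)) := by
  rw [gaussianKernel, ← Real.exp_add, ← Real.exp_add]
  congr 1
  by_cases h : ℓ = 0
  · simp [h]
  · field_simp
    ring

/-- The Gaussian kernel is positive semidefinite, so that it has an RKHS. -/
theorem posSemidef_gaussianKernelMatrix (ℓ : ℝ) : (gaussianKernelMatrix ℓ).PosSemidef := by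
  refine ((RKHS.posSemidef_tfae (K := gaussianKernelMatrix ℓ)).out 0 2 rfl rfl).mpr ⟨?_, fun v => ?_⟩
  · ext x y
    refine ext_inner_right ℝ fun z => ?_
    rw [Matrix.conjTranspose_apply, ContinuousLinearMap.star_eq_adjoint,
      ContinuousLinearMap.adjoint_inner_left]
    simp [gaussianKernelMatrix, gaussianKernel, sub_sq_comm x y, mul_comm]
  · simp only [RCLike.re_to_real, Finsupp.sum]
    have key : ∀ x y : ℝ, HasSum (fun n : ℕ => ((n ! : ℝ)⁻¹) *
        ((v x * Real.exp (-x ^ 2 / (2 * ℓ ^ 2)) * (x / ℓ) ^ n) *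
         (v y * Real.exp (-y ^ 2 / (2 * ℓ ^ 2)) * (y / ℓ) ^ n)))
        (inner ℝ (gaussianKernelMatrix ℓ y x (v x)) (v y)) := by
      intro x y
      have h := (Real.exp_eq_exp_ℝ ▸ NormedSpace.expSeries_div_hasSum_exp ((x / ℓ) * (y / ℓ)) :
        HasSum (fun n : ℕ => ((x / ℓ) * (y / ℓ)) ^ n / (n ! : ℝ)) (Real.exp ((x / ℓ) * (y / ℓ)))).mul_left
        (v x * Real.exp (-x ^ 2 / (2 * ℓ ^ 2)) * (v y * Real.exp (-y ^ 2 / (2 * ℓ ^ 2))))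
      have h1 : inner ℝ (gaussianKernelMatrix ℓ y x (v x)) (v y) =
          v x * Real.exp (-x ^ 2 / (2 * ℓ ^ 2)) * (v y * Real.exp (-y ^ 2 / (2 * ℓ ^ 2))) *
            Real.exp ((x / ℓ) * (y / ℓ)) := by
        simp only [gaussianKernelMatrix, Matrix.of_apply, gaussianKernel_eq, FunLike.coe_smul,
          Pi.smul_apply, ContinuousLinearMap.id_apply, smul_eq_mul, RCLike.inner_apply,
          conj_trivial]
        rw [mul_comm (y / ℓ)]
        ring
      rw [h1]
      refine Eq.mpr (congrArg (fun g : ℕ → ℝ => HasSum g _) (funext fun n => ?_)) h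
      simp only [mul_pow, div_eq_mul_inv]
      ring
    refine (hasSum_sum fun x _ => hasSum_sum fun y _ => key x y).nonneg fun n => ?_
    simp only [← Finset.mul_sum, ← Finset.sum_mul]
    rw [← sq]
    positivity

instance (ℓ : ℝ) : Fact (gaussianKernelMatrix ℓ).PosSemidef :=
  ⟨posSemidef_gaussianKernelMatrix ℓ⟩

/-- The reproducing kernel Hilbert space of real functions on `ℝ` induced by the Gaussian kernel. -/
abbrev GaussianRKHS (ℓ : ℝ) : Type := RKHS.OfKernel (gaussianKernelMatrix ℓ)

/-- The quadrature rule `Q(f) = ∑ wₙ f(xₙ)`. -/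
def quadrature {N : ℕ} (x w : Fin N → ℝ) (f : ℝ → ℝ) : ℝ := ∑ n, w n * f (x n)

/-- Integration against the standard Gaussian measure. -/
def gaussianIntegral (f : ℝ → ℝ) : ℝ := ∫ t, f t ∂(gaussianReal 0 1)

/-- The worst-case error `e(Q) = sup {|μ(f) - Q(f)| : ‖f‖ ≤ 1}` over the unit ball of the RKHS of
the Gaussian kernel, as an extended nonnegative number. -/
def worstCaseError (ℓ : ℝ) {N : ℕ} (x w : Fin N → ℝ) : ℝ≥0∞ :=
  ⨆ (f : GaussianRKHS ℓ) (_ : ‖f‖ ≤ 1), ENNReal.ofReal |gaussianIntegral f - quadrature x w f|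

/-- Every member of the RKHS is integrable, so that the integral in `worstCaseError` is genuine. -/
theorem integrable_gaussianRKHS (ℓ : ℝ) (f : GaussianRKHS ℓ) :
    Integrable f (gaussianReal 0 1) := by
  have hK : ∀ x y : ℝ, RKHS.kernel (GaussianRKHS ℓ) x y 1 = gaussianKernel ℓ x y := by
    intro x y
    rw [RKHS.OfKernel.kernel_ofKernel]
    simp [gaussianKernelMatrix]
  let e : ℝ → GaussianRKHS ℓ := fun x => RKHS.kerFun (GaussianRKHS ℓ) x 1
  have he : ∀ x y : ℝ, inner ℝ (e x) (e y) = gaussianKernel ℓ x y := by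
    intro x y
    simp only [e]
    rw [RKHS.kerFun_inner, RKHS.kerFun_apply, hK]
    simp
  have hf : ∀ x : ℝ, f x = inner ℝ (e x) f := by
    intro x
    simp only [e]
    rw [RKHS.kerFun_inner]
    simp
  have hn : ∀ x : ℝ, ‖e x‖ = 1 := by
    intro x
    have h := real_inner_self_eq_norm_sq (e x)
    rw [he] at h
    simp only [gaussianKernel, sub_self, ne_eq, OfNat.ofNat_ne_zero, not_false_eq_true, zero_pow,
      neg_zero, zero_div, Real.exp_zero] at h
    nlinarith [norm_nonneg (e x)]
  have hd : ∀ x y : ℝ, dist (e x) (e y) = √(2 - 2 * gaussianKernel ℓ x y) := by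
    intro x y
    rw [dist_eq_norm, ← Real.sqrt_sq (norm_nonneg (e x - e y)), norm_sub_sq_real, hn, hn, he]
    congr 1
    ring
  have hc : Continuous e := by
    rw [continuous_iff_continuousAt]
    intro x
    rw [ContinuousAt, tendsto_iff_dist_tendsto_zero]
    simp only [hd]
    have h : Continuous fun y : ℝ => √(2 - 2 * gaussianKernel ℓ y x) := by
      unfold gaussianKernel
      fun_prop
    simpa [gaussianKernel] using h.tendsto x
  have hfc : Continuous f := by
    have h : (f : ℝ → ℝ) = fun x => inner ℝ (e x) f := funext hf
    rw [h]
    exact hc.inner continuous_const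
  refine Integrable.of_bound hfc.aestronglyMeasurable ‖f‖ (Filter.Eventually.of_forall fun x => ?_)
  rw [hf]
  simpa [hn] using norm_inner_le_norm (𝕜 := ℝ) (e x) f

/-- `ε = 1 / (√2 ℓ)`. -/
def epsilon (ℓ : ℝ) : ℝ := 1 / (√2 * ℓ)

/-- `β = (1 + (2ε/α)²)^(1/4)`. -/
def beta (α ℓ : ℝ) : ℝ := (1 + (2 * epsilon ℓ / α) ^ 2) ^ (1 / 4 : ℝ)

/-- `δ² = (α²/2) (β² - 1)`. -/
def deltaSq (α ℓ : ℝ) : ℝ := α ^ 2 / 2 * (beta α ℓ ^ 2 - 1)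

/-- The Mercer eigenfunction `φₙ(x) = √(β/n!) exp(-δ²x²) Hₙ(√2 α β x)`, where `Hₙ` is the
probabilists' Hermite polynomial. -/
def eigenfunction (α ℓ : ℝ) (n : ℕ) (x : ℝ) : ℝ :=
  √(beta α ℓ / n !) * Real.exp (-deltaSq α ℓ * x ^ 2) *
    Polynomial.aeval (√2 * α * beta α ℓ * x) (Polynomial.hermite n)

/-- The factor `τ` in the Mercer eigenvalues `τ λⁿ`. -/
def eigenvaluePrefactor (α ℓ : ℝ) : ℝ :=
  √(α ^ 2 / (α ^ 2 + deltaSq α ℓ + epsilon ℓ ^ 2))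

/-- The ratio `λ` in the Mercer eigenvalues `τ λⁿ`. -/
def eigenvalueRatio (α ℓ : ℝ) : ℝ :=
  epsilon ℓ ^ 2 / (α ^ 2 + deltaSq α ℓ + epsilon ℓ ^ 2)

/-- `C₁ = K √β`. -/
def constC₁ (K α ℓ : ℝ) : ℝ := K * √(beta α ℓ)

/-- `C₂ = √τ / (1 - √λ)`. -/
def constC₂ (α ℓ : ℝ) : ℝ := √(eigenvaluePrefactor α ℓ) / (1 - √(eigenvalueRatio α ℓ))

/-- `η = √λ exp(1/β²)`. -/
def rate (α ℓ : ℝ) : ℝ := √(eigenvalueRatio α ℓ) * Real.exp (1 / beta α ℓ ^ 2)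

end

end GaussianQuadrature

/-!
The proof uses the Mercer feature map `Φ(x) = (√(τ λⁿ) φₙ(x))ₙ` into `ℓ²`. By Mehler's formula it
has the same Gram matrix as the canonical feature map `x ↦ k(x, ·)` of the RKHS, so the worst-case
error, which is the norm of the representer of `f ↦ μ(f) - Q(f)`, can be computed in `ℓ²`:
`e(Q)² = ∑ₙ τ λⁿ (μ(φₙ) - Q(φₙ))²`. This is `norm_sq_errorRepresenter` together with
`norm_sq_errorRepresenter_mercer`. The terms with `n < M` vanish. For `n ≥ M` the estimate
`|μ(φₙ)| ≤ 1` follows from `∫ φₙ² dμ = 1`, and `|Q(φₙ)| ≤ W √β e^{M/β²}` follows from the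
restriction on the nodes and the pointwise bound `|φₙ(x)| ≤ √β e^{x²/4}`. Since `τ = 1 - λ`, summing
the geometric series gives `e(Q) ≤ (1 + W √β e^{M/β²}) λ^{M/2}`, so that `K = 1` is admissible; the
factors `C₂ ≥ 1` and `e^{M/β²} ≥ 1` only weaken this to the claimed bound.

Both facts on Hermite polynomials come from `Hₙ(y) = 𝔼[(y + iZ)ⁿ]`, `Z` standard Gaussian, where the
line of integration may be shifted to any `ℝ + ia` (`integral_shiftedMoment`). Without a shift,
exchanging sum and integral proves Mehler's formula (`hasSum_hermite_mul_hermite`). With `a = y / 2`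
one gets `|Hₙ(y)| e^{-y²/4} ≤ (2π)^{-1/2} ∫ rⁿ e^{-r²/2} du`, `r² = u² + (y/2)²`, the integral of a
radial function over a line. In the variable `ρ = r² / 2` this function is `2^m ρᵐ e^{-ρ}`,
`m = n / 2`, whose maximum and first moment along the line are controlled independently of `y`; this
gives Cramér's inequality `|Hₙ(y)| ≤ √n! e^{y²/4}` (`abs_hermite_le`).
-/

namespace GaussianQuadrature

/-! ### Gaussian integration by parts -/

theorem integrable_gaussianReal_iff {E : Type*} [NormedAddCommGroup E] [NormedSpace ℝ E]
    {g : ℝ → E} :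
    Integrable g (gaussianReal 0 1) ↔ Integrable (fun u => gaussianPDFReal 0 1 u • g u) := by
  rw [gaussianReal_of_var_ne_zero 0 one_ne_zero,
    integrable_withDensity_iff_integrable_smul' (measurable_gaussianPDF 0 1)
      (Filter.Eventually.of_forall fun _ => gaussianPDF_lt_top)]
  simp only [toReal_gaussianPDF]

theorem hasDerivAt_gaussianPDFReal (u : ℝ) :
    HasDerivAt (gaussianPDFReal 0 1) (-u * gaussianPDFReal 0 1 u) u := by
  have h : HasDerivAt (fun x : ℝ => -(x - 0) ^ 2 / (2 * ((1 : NNReal) : ℝ))) (-u) u := by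
    have := (((hasDerivAt_id u).sub_const 0).pow 2).neg.div_const (2 * ((1 : NNReal) : ℝ))
    convert! this using 1
    simp
    ring
  have h2 := h.exp.const_mul (√(2 * Real.pi * ((1 : NNReal) : ℝ)))⁻¹
  unfold gaussianPDFReal
  convert! h2 using 1
  ring

/-- Gaussian integration by parts (Stein's identity). -/
theorem integral_deriv_gaussianReal {E : Type*} [NormedAddCommGroup E] [NormedSpace ℝ E]
    {g g' : ℝ → E} (hg : ∀ u, HasDerivAt g (g' u) u) (h0 : Integrable g (gaussianReal 0 1))
    (h1 : Integrable g' (gaussianReal 0 1))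
    (h2 : Integrable (fun u => u • g u) (gaussianReal 0 1)) :
    ∫ u, g' u ∂(gaussianReal 0 1) = ∫ u, u • g u ∂(gaussianReal 0 1) := by
  have hd : ∀ u, HasDerivAt (fun u => gaussianPDFReal 0 1 u • g u)
      (gaussianPDFReal 0 1 u • g' u - gaussianPDFReal 0 1 u • u • g u) u := by
    intro u
    convert! (hasDerivAt_gaussianPDFReal u).smul (hg u) using 1
    rw [sub_eq_add_neg, ← smul_assoc, ← neg_smul]
    congr 2
    simp [mul_comm]
  rw [integrable_gaussianReal_iff] at h0 h1 h2
  have := integral_eq_zero_of_hasDerivAt_of_integrable hd (h1.sub h2) h0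
  rw [integral_sub h1 h2, sub_eq_zero] at this
  rwa [integral_gaussianReal_eq_integral_smul one_ne_zero,
    integral_gaussianReal_eq_integral_smul one_ne_zero]

theorem integrable_norm_add_mul_I_pow (c : ℂ) (n : ℕ) :
    Integrable (fun u : ℝ => ‖c + u * Complex.I‖ ^ n) (gaussianReal 0 1) := by
  have h1 : MemLp (fun u : ℝ => (u : ℂ) * Complex.I) (n : ℝ≥0∞) (gaussianReal 0 1) := by
    have h := memLp_id_gaussianReal (μ := 0) (v := 1) (n : NNReal)
    refine MemLp.of_le (by simpa using h) (by fun_prop) (Filter.Eventually.of_forall fun u => ?_)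
    simp
  rcases Nat.eq_zero_or_pos n with rfl | hn
  · simp
  · exact ((memLp_const c).add h1).integrable_norm_pow hn.ne'

/-! ### Hermite polynomials as complex Gaussian moments -/

theorem derivative_hermite_succ (n : ℕ) :
    Polynomial.derivative (Polynomial.hermite (n + 1)) =
      ((n : Polynomial ℤ) + 1) * Polynomial.hermite n := by
  induction n with
  | zero => simp
  | succ n ih =>
    rw [Polynomial.hermite_succ (n + 1), Polynomial.derivative_sub, Polynomial.derivative_mul, ih,
      Polynomial.derivative_mul, Polynomial.hermite_succ n]
    simp
    ring

theorem hermite_add_two (n : ℕ) :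
    Polynomial.hermite (n + 2) =
      Polynomial.X * Polynomial.hermite (n + 1) -
        ((n : Polynomial ℤ) + 1) * Polynomial.hermite n := by
  rw [Polynomial.hermite_succ (n + 1), derivative_hermite_succ]

/-- The integrand `(y + iz)ⁿ` at `z = u + ia`, times the density of the Gaussian at `u + ia`
relative to the one at `u`. -/
noncomputable def shiftedMoment (a y : ℝ) (n : ℕ) (u : ℝ) : ℂ :=
  ((y - a : ℂ) + u * Complex.I) ^ n * Complex.exp (-(a * u * Complex.I) + a ^ 2 / 2)

theorem norm_shiftedMoment (a y : ℝ) (n : ℕ) (u : ℝ) :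
    ‖shiftedMoment a y n u‖ = Real.exp (a ^ 2 / 2) * ‖(y - a : ℂ) + u * Complex.I‖ ^ n := by
  rw [shiftedMoment, norm_mul, norm_pow, Complex.norm_exp, mul_comm]
  congr 2
  have : (a : ℂ) ^ 2 / 2 = ((a ^ 2 / 2 : ℝ) : ℂ) := by push_cast; rfl
  rw [Complex.add_re, this, Complex.ofReal_re]
  simp

theorem integrable_shiftedMoment (a y : ℝ) (n : ℕ) :
    Integrable (shiftedMoment a y n) (gaussianReal 0 1) := by
  rw [← integrable_norm_iff (by unfold shiftedMoment; fun_prop)]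
  simp only [norm_shiftedMoment]
  exact (integrable_norm_add_mul_I_pow _ n).const_mul _

theorem hasDerivAt_shiftedMoment (a y : ℝ) (n : ℕ) (u : ℝ) :
    HasDerivAt (shiftedMoment a y n)
      (n * Complex.I * shiftedMoment a y (n - 1) u - a * Complex.I * shiftedMoment a y n u) u := by
  have h1 : HasDerivAt (fun u : ℝ => (y - a : ℂ) + u * Complex.I) Complex.I u := by
    simpa using ((Complex.ofRealCLM.hasDerivAt (x := u)).mul_const Complex.I).const_add (y - a : ℂ)
  have h2 : HasDerivAt (fun u : ℝ => -(a * u * Complex.I) + (a : ℂ) ^ 2 / 2)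
      (-(a * Complex.I)) u := by
    simpa using ((((Complex.ofRealCLM.hasDerivAt (x := u)).const_mul (a : ℂ)).mul_const
      Complex.I).neg.add_const ((a : ℂ) ^ 2 / 2))
  unfold shiftedMoment
  convert! (h1.pow n).mul h2.cexp using 1
  simp only [Pi.pow_apply]
  ring

theorem smul_shiftedMoment (a y : ℝ) (n : ℕ) (u : ℝ) :
    u • shiftedMoment a y n u =
      -Complex.I * (shiftedMoment a y (n + 1) u - (y - a) * shiftedMoment a y n u) := by
  rw [Complex.real_smul, shiftedMoment, shiftedMoment, pow_succ _ n]
  linear_combination (u * ((y - a : ℂ) + u * Complex.I) ^ n *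
    Complex.exp (-(a * u * Complex.I) + (a : ℂ) ^ 2 / 2)) * Complex.I_mul_I

/-- The shifted moments satisfy the three-term recurrence of the Hermite polynomials. -/
theorem integral_shiftedMoment_succ (a y : ℝ) (n : ℕ) :
    ∫ u, shiftedMoment a y (n + 1) u ∂(gaussianReal 0 1) =
      y * ∫ u, shiftedMoment a y n u ∂(gaussianReal 0 1) -
        n * ∫ u, shiftedMoment a y (n - 1) u ∂(gaussianReal 0 1) := by
  have hi := integrable_shiftedMoment a y
  have h := integral_deriv_gaussianReal (hasDerivAt_shiftedMoment a y n) (hi _)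
    (((hi (n - 1)).const_mul _).sub ((hi n).const_mul _))
    (by
      simp only [smul_shiftedMoment]
      exact ((hi _).sub ((hi _).const_mul _)).const_mul _)
  simp only [smul_shiftedMoment] at h
  rw [integral_sub ((hi (n - 1)).const_mul _) ((hi n).const_mul _), integral_const_mul,
    integral_const_mul, integral_const_mul, integral_sub (hi _) ((hi _).const_mul _),
    integral_const_mul] at h
  linear_combination (-Complex.I) * h + (∫ u, shiftedMoment a y (n + 1) u ∂(gaussianReal 0 1) -
      y * ∫ u, shiftedMoment a y n u ∂(gaussianReal 0 1) +
        n * ∫ u, shiftedMoment a y (n - 1) u ∂(gaussianReal 0 1)) * Complex.I_mul_I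

theorem integral_shiftedMoment_zero (a y : ℝ) :
    ∫ u, shiftedMoment a y 0 u ∂(gaussianReal 0 1) = 1 := by
  have h := charFun_gaussianReal (μ := 0) (v := 1) (-a)
  rw [charFun_apply_real] at h
  simp only [shiftedMoment, pow_zero, one_mul, Complex.exp_add]
  rw [integral_mul_const]
  have e : ∀ u : ℝ, -((a : ℂ) * u * Complex.I) = ((-a : ℝ) : ℂ) * u * Complex.I := by
    intro u
    push_cast
    ring
  simp only [e]
  rw [h, ← Complex.exp_add]
  simp

/-- `Hₙ(y) = 𝔼[(y + iZ)ⁿ]` for a standard Gaussian `Z`, with the line of integration moved from `ℝ`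
to `ℝ + ia`. -/
theorem integral_shiftedMoment (a y : ℝ) (n : ℕ) :
    ∫ u, shiftedMoment a y n u ∂(gaussianReal 0 1) =
      ((Polynomial.aeval y (Polynomial.hermite n) : ℝ) : ℂ) := by
  induction n using Nat.twoStepInduction with
  | zero => simp [integral_shiftedMoment_zero]
  | one =>
    rw [integral_shiftedMoment_succ]
    simp [integral_shiftedMoment_zero]
  | more n ih0 ih1 =>
    rw [integral_shiftedMoment_succ, Nat.add_sub_cancel, ih0, ih1, hermite_add_two]
    simp

/-! ### Cramér's inequality -/

theorem rpow_mul_exp_neg_le {m ρ : ℝ} (hm : 0 < m) (hρ : 0 ≤ ρ) :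
    ρ ^ m * Real.exp (-ρ) ≤ m ^ m * Real.exp (-m) := by
  have h1 : ρ / m ≤ Real.exp (ρ / m - 1) := by
    simpa using Real.add_one_le_exp (ρ / m - 1)
  have h2 := Real.rpow_le_rpow (by positivity) h1 hm.le
  rw [Real.div_rpow hρ hm.le, ← Real.exp_mul, div_le_iff₀ (by positivity)] at h2
  have h3 : (ρ / m - 1) * m = ρ - m := by field_simp
  rw [h3] at h2
  calc ρ ^ m * Real.exp (-ρ) ≤ Real.exp (ρ - m) * m ^ m * Real.exp (-ρ) := by gcongr
    _ = m ^ m * (Real.exp (ρ - m) * Real.exp (-ρ)) := by ring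
    _ = m ^ m * Real.exp (-m) := by
      rw [← Real.exp_add]
      congr 2
      ring

/-- A nonnegative function on `(0, ∞)` bounded by `P` with first moment at most `G` has integral at
most `√(2PG)`: on `(0, U)` interpolate between the bound `P` and the weight `u / U`, and choose
`U = √(2G / P)`. -/
theorem setIntegral_Ioi_le_of_le_of_moment_le {ψ : ℝ → ℝ} {P G : ℝ} (hP : 0 < P) (hG : 0 < G)
    (h0 : ∀ u, 0 ≤ ψ u) (hψP : ∀ u, ψ u ≤ P) (hi : IntegrableOn ψ (Set.Ioi 0))
    (hi1 : IntegrableOn (fun u => ψ u * u) (Set.Ioi 0))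
    (hGm : ∫ u in Set.Ioi 0, ψ u * u ≤ G) :
    ∫ u in Set.Ioi 0, ψ u ≤ √(2 * P * G) := by
  set U := √(2 * G / P) with hU
  have hUpos : 0 < U := by positivity
  have hci : Integrable ((Set.Ioc 0 U).indicator (fun u => P * (1 - u / U))) := by
    rw [integrable_indicator_iff measurableSet_Ioc]
    exact (Continuous.integrableOn_Ioc (by fun_prop))
  have hcv : ∫ u in Set.Ioi 0, (Set.Ioc 0 U).indicator (fun u => P * (1 - u / U)) u =
      P * U / 2 := by
    rw [setIntegral_indicator measurableSet_Ioc,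
      Set.inter_eq_self_of_subset_right Set.Ioc_subset_Ioi_self,
      ← intervalIntegral.integral_of_le hUpos.le, intervalIntegral.integral_const_mul,
      intervalIntegral.integral_sub (by simp)
        (Continuous.intervalIntegrable (by fun_prop) _ _), intervalIntegral.integral_div]
    simp
    field_simp
    ring
  have hle : ∫ u in Set.Ioi 0, ψ u ≤
      ∫ u in Set.Ioi 0, ((Set.Ioc 0 U).indicator (fun u => P * (1 - u / U)) u + ψ u * u / U) := by
    refine setIntegral_mono_on hi (hci.integrableOn.add (hi1.div_const U)) measurableSet_Ioi ?_
    intro u hu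
    rw [Set.mem_Ioi] at hu
    by_cases hc : u ≤ U
    · rw [Set.indicator_of_mem (Set.mem_Ioc.2 ⟨hu, hc⟩)]
      have h1 : 0 ≤ 1 - u / U := by
        rw [sub_nonneg, div_le_one hUpos]
        exact hc
      have := mul_le_mul_of_nonneg_right (hψP u) h1
      calc ψ u = ψ u * (1 - u / U) + ψ u * u / U := by ring
        _ ≤ _ := by gcongr
    · rw [Set.indicator_of_notMem (fun h => hc h.2), zero_add, mul_div_assoc]
      exact le_mul_of_one_le_right (h0 u) ((one_le_div hUpos).2 (not_le.1 hc).le)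
  rw [integral_add hci.integrableOn (hi1.div_const U), hcv, integral_div] at hle
  have hU2 : U ^ 2 = 2 * G / P := Real.sq_sqrt (by positivity)
  have hPU : √(2 * P * G) = P * U := by
    have h : 2 * P * G = (P * U) ^ 2 := by
      rw [mul_pow, hU2]
      field_simp
    rw [h, Real.sqrt_sq (by positivity)]
  have hGU : G / U = P * U / 2 := by
    rw [div_eq_iff hUpos.ne']
    calc G = P * (2 * G / P) / 2 := by field_simp
      _ = _ := by rw [← hU2]; ring
  calc _ ≤ P * U / 2 + G / U := hle.trans (by gcongr)
    _ = _ := by rw [hGU, hPU]; ring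

/-- The radial function `ρᵐ e^{-ρ}`, `ρ = (v² + u²) / 2`, on the line at distance `v` from the
origin. -/
noncomputable def radialProfile (m v u : ℝ) : ℝ :=
  ((v ^ 2 + u ^ 2) / 2) ^ m * Real.exp (-((v ^ 2 + u ^ 2) / 2))

theorem radialProfile_nonneg (m v u : ℝ) : 0 ≤ radialProfile m v u := by
  unfold radialProfile
  positivity

/-- For `m = n / 2` the radial function is, up to a constant, the norm of `(v + iu)ⁿ` times the
Gaussian density. -/
theorem radialProfile_eq (n : ℕ) (v u : ℝ) :
    radialProfile (n / 2) v u = (√(2 * Real.pi) * Real.exp (-(v ^ 2 / 2)) / 2 ^ ((n : ℝ) / 2)) *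
      (gaussianPDFReal 0 1 u * ‖(v : ℂ) + u * Complex.I‖ ^ n) := by
  have h1 : ‖(v : ℂ) + u * Complex.I‖ ^ n = (v ^ 2 + u ^ 2) ^ ((n : ℝ) / 2) := by
    rw [Complex.norm_add_mul_I, Real.sqrt_eq_rpow, ← Real.rpow_natCast,
      ← Real.rpow_mul (by positivity)]
    congr 1
    ring
  have h2 : Real.exp (-((v ^ 2 + u ^ 2) / 2)) =
      Real.exp (-(v ^ 2 / 2)) * Real.exp (-u ^ 2 / 2) := by
    rw [← Real.exp_add]
    congr 1
    ring
  rw [radialProfile, h1, h2, Real.div_rpow (by positivity) two_pos.le, gaussianPDFReal]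
  simp
  field_simp

theorem integrable_radialProfile (n : ℕ) (v : ℝ) : Integrable (radialProfile (n / 2) v) := by
  simp only [funext (radialProfile_eq n v)]
  exact (integrable_gaussianReal_iff.1 (integrable_norm_add_mul_I_pow v n)).const_mul _

theorem integrable_radialProfile_mul (n : ℕ) (v : ℝ) :
    Integrable (fun u => radialProfile (n / 2) v u * u) := by
  have h : Integrable (fun u : ℝ => ‖(v : ℂ) + u * Complex.I‖ ^ n * u) (gaussianReal 0 1) := by
    refine (integrable_norm_add_mul_I_pow v (n + 1)).mono' (by fun_prop)
      (Filter.Eventually.of_forall fun u => ?_)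
    rw [norm_mul, norm_pow, norm_norm, pow_succ]
    gcongr
    simpa using Complex.abs_im_le_norm ((v : ℂ) + u * Complex.I)
  simp only [radialProfile_eq, mul_assoc]
  exact (integrable_gaussianReal_iff.1 h).const_mul _

/-- The substitution `ρ = (v² + u²) / 2` turns the first moment into a tail of the Gamma integral.
-/
theorem setIntegral_radialProfile_mul_le {m v : ℝ} (hm : 0 < m)
    (hi : Integrable (fun u => radialProfile m v u * u)) :
    ∫ u in Set.Ioi 0, radialProfile m v u * u ≤ Real.Gamma (m + 1) := by
  have hgi : IntegrableOn (fun ρ : ℝ => ρ ^ m * Real.exp (-ρ)) (Set.Ioi 0) := by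
    have := Real.GammaIntegral_convergent (s := m + 1) (by positivity)
    simpa [mul_comm] using this
  have hgc : Continuous (fun ρ : ℝ => ρ ^ m * Real.exp (-ρ)) := by
    have : Continuous fun ρ : ℝ => ρ ^ m :=
      Continuous.rpow_const (by fun_prop) fun _ => Or.inr hm.le
    fun_prop
  have hsub : ∫ u in Set.Ioi 0, radialProfile m v u * u =
      ∫ ρ in Set.Ioi ((v ^ 2 + 0 ^ 2) / 2), ρ ^ m * Real.exp (-ρ) := by
    refine integral_comp_mul_deriv_Ioi (f := fun u : ℝ => (v ^ 2 + u ^ 2) / 2)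
      (g := fun ρ : ℝ => ρ ^ m * Real.exp (-ρ)) (by fun_prop) ?_ ?_ hgc.continuousOn ?_ ?_
    · refine Filter.Tendsto.atTop_div_const two_pos (Filter.tendsto_atTop_add_const_left _ _ ?_)
      exact Filter.tendsto_pow_atTop two_ne_zero
    · intro x _
      have := (((hasDerivAt_id x).pow 2).const_add (v ^ 2)).div_const 2
      refine HasDerivAt.hasDerivWithinAt ?_
      convert! this using 1
      simp
    · rw [← integrableOn_Ici_iff_integrableOn_Ioi] at hgi
      refine hgi.mono_set ?_
      rintro _ ⟨u, _, rfl⟩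
      simp only [Set.mem_Ici]
      positivity
    · exact hi.integrableOn
  rw [hsub, Real.Gamma_eq_integral (by positivity)]
  simp only [add_sub_cancel_right, mul_comm (Real.exp _)]
  refine setIntegral_mono_set hgi ?_ ?_
  · filter_upwards [ae_restrict_mem measurableSet_Ioi] with ρ hρ
    have : (0 : ℝ) < ρ := hρ
    simp only [Pi.zero_apply]
    positivity
  · refine LE.le.eventuallyLE fun ρ hρ => ?_
    have : (v ^ 2 + 0 ^ 2) / 2 < ρ := hρ
    exact lt_of_le_of_lt (by positivity) this

theorem integral_radialProfile_le {n : ℕ} (hn : 0 < n) (v : ℝ) :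
    ∫ u, radialProfile (n / 2) v u ≤
      2 * √(2 * (((n : ℝ) / 2) ^ ((n : ℝ) / 2) * Real.exp (-((n : ℝ) / 2))) *
        Real.Gamma ((n : ℝ) / 2 + 1)) := by
  have hm : 0 < (n : ℝ) / 2 := by positivity
  have he : ∫ u, radialProfile (n / 2) v u = 2 * ∫ u in Set.Ioi 0, radialProfile (n / 2) v u := by
    rw [← integral_comp_abs]
    simp [radialProfile]
  rw [he]
  gcongr
  exact setIntegral_Ioi_le_of_le_of_moment_le (by positivity)
    (Real.Gamma_pos_of_pos (by positivity))
    (radialProfile_nonneg _ v) (fun u => rpow_mul_exp_neg_le hm (by positivity))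
    (integrable_radialProfile n v).integrableOn (integrable_radialProfile_mul n v).integrableOn
    (setIntegral_radialProfile_mul_le hm (integrable_radialProfile_mul n v))

theorem mul_log_sub_mul_log_le {s : ℝ} (h0 : 0 ≤ s) (h1 : s < 1) :
    (1 + s) * Real.log (1 + s) - (1 - s) * Real.log (1 - s) ≤ 2 * s := by
  have hd : ∀ x ∈ Set.Ioo (0 : ℝ) 1, HasDerivAt
      (fun x : ℝ => 2 * x - ((1 + x) * Real.log (1 + x) - (1 - x) * Real.log (1 - x)))
      (-(Real.log (1 + x) + Real.log (1 - x))) x := by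
    intro x hx
    have ha := (Real.hasDerivAt_mul_log (x := 1 + x) (by linarith [hx.1])).comp x
      ((hasDerivAt_id x).const_add 1)
    have hb := (Real.hasDerivAt_mul_log (x := 1 - x) (by linarith [hx.2])).comp x
      ((hasDerivAt_id x).const_sub 1)
    convert! ((hasDerivAt_id x).const_mul 2).sub (ha.sub hb) using 1
    ring
  have hmono : MonotoneOn
      (fun x : ℝ => 2 * x - ((1 + x) * Real.log (1 + x) - (1 - x) * Real.log (1 - x)))
      (Set.Ico 0 1) := by
    refine monotoneOn_of_deriv_nonneg (convex_Ico 0 1) ?_ ?_ ?_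
    · refine Continuous.continuousOn ?_
      have h := Real.continuous_mul_log
      exact (continuous_const.mul continuous_id).sub
        ((h.comp (continuous_const.add continuous_id)).sub
          (h.comp (continuous_const.sub continuous_id)))
    · rw [interior_Ico]
      exact fun x hx => (hd x hx).differentiableAt.differentiableWithinAt
    · rw [interior_Ico]
      intro x hx
      rw [(hd x hx).deriv, ← Real.log_mul (by linarith [hx.1]) (by linarith [hx.2])]
      have : Real.log ((1 + x) * (1 - x)) ≤ 0 :=
        Real.log_nonpos (by nlinarith [hx.1, hx.2]) (by nlinarith [hx.1])
      linarith
  have := hmono (Set.mem_Ico.2 ⟨le_rfl, one_pos⟩) (Set.mem_Ico.2 ⟨h0, h1⟩) h0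
  simp at this
  linarith

/-- One induction step for comparing `mᵐ e⁻ᵐ` with `Γ(m + 1/2)`. -/
theorem rpow_self_mul_exp_neg_add_one_le {m : ℝ} (hm : 0 < m) :
    (m + 1) ^ (m + 1) * Real.exp (-(m + 1)) ≤ (m + 1 / 2) * (m ^ m * Real.exp (-m)) := by
  have ha : 0 < m + 1 / 2 := by positivity
  -- With `a = m + 1/2` and `s = 1 / (2a)`, one has `m = a (1 - s)` and `m + 1 = a (1 + s)`.
  set s := 1 / (2 * (m + 1 / 2)) with hs
  have hs0 : 0 < s := by positivity
  have hs1 : s < 1 := by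
    rw [hs, div_lt_one (by positivity)]
    linarith
  have h := mul_le_mul_of_nonneg_left (mul_log_sub_mul_log_le hs0.le hs1) ha.le
  have e1 : m + 1 = (m + 1 / 2) * (1 + s) := by
    rw [hs]
    field_simp
    ring
  have e2 : m = (m + 1 / 2) * (1 - s) := by
    rw [hs]
    field_simp
    ring
  have l1 : Real.log (m + 1) = Real.log (m + 1 / 2) + Real.log (1 + s) := by
    rw [← Real.log_mul ha.ne' (by positivity), ← e1]
  have l2 : Real.log m = Real.log (m + 1 / 2) + Real.log (1 - s) := by
    rw [← Real.log_mul ha.ne' (by linarith), ← e2]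
  rw [Real.rpow_def_of_pos (by positivity), Real.rpow_def_of_pos hm, ← Real.exp_add, ← Real.exp_add]
  suffices h' : Real.log (m + 1) * (m + 1) + -(m + 1) ≤
      Real.log (m + 1 / 2) + (Real.log m * m + -m) by
    simpa only [Real.exp_add (Real.log (m + 1 / 2)), Real.exp_log ha] using Real.exp_le_exp.2 h'
  rw [l1, l2]
  have e3 : (m + 1 / 2) * s = 1 / 2 := by
    rw [hs]
    field_simp
  nlinarith [h, e3, congrArg (· * Real.log (1 + s)) e1, congrArg (· * Real.log (1 - s)) e2]

/-- The bound follows by induction in steps of two, since `mᵐ e⁻ᵐ / Γ(m + 1/2)` decreases when `m`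
grows by one. -/
theorem four_div_sqrt_pi_mul_le_Gamma (n : ℕ) :
    4 / √Real.pi * ((((n : ℝ) + 1) / 2) ^ (((n : ℝ) + 1) / 2) * Real.exp (-(((n : ℝ) + 1) / 2))) ≤
      Real.Gamma (((n : ℝ) + 1) / 2 + 1 / 2) := by
  have hsp : √Real.pi ^ 2 = Real.pi := Real.sq_sqrt Real.pi_pos.le
  have hbase : 8 * Real.exp (-1) ≤ Real.pi := by
    rw [Real.exp_neg, ← div_eq_mul_inv, div_le_iff₀ (Real.exp_pos 1)]
    nlinarith [Real.pi_gt_three, Real.exp_one_gt_d9]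
  induction n using Nat.twoStepInduction with
  | zero =>
    norm_num
    rw [← Real.sqrt_eq_rpow, div_mul_eq_mul_div, div_le_one (by positivity)]
    refine Real.le_sqrt_of_sq_le ?_
    rw [mul_pow, mul_pow, ← Real.exp_nat_mul, Real.sq_sqrt (by norm_num)]
    norm_num
    linarith
  | one =>
    have h : Real.Gamma (3 / 2) = √Real.pi / 2 := by
      rw [show (3 / 2 : ℝ) = 1 / 2 + 1 by norm_num, Real.Gamma_add_one (by norm_num),
        Real.Gamma_one_half_eq]
      ring
    norm_num
    rw [h, div_mul_eq_mul_div, div_le_div_iff₀ (by positivity) two_pos, ← sq, hsp]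
    linarith
  | more n ih0 _ =>
    have hm : 0 < ((n : ℝ) + 1) / 2 := by positivity
    have e1 : (((n + 2 : ℕ) : ℝ) + 1) / 2 = ((n : ℝ) + 1) / 2 + 1 := by
      push_cast
      ring
    rw [e1, add_right_comm, Real.Gamma_add_one (by positivity)]
    calc _ ≤ 4 / √Real.pi * ((((n : ℝ) + 1) / 2 + 1 / 2) *
          ((((n : ℝ) + 1) / 2) ^ (((n : ℝ) + 1) / 2) * Real.exp (-(((n : ℝ) + 1) / 2)))) := by
          exact mul_le_mul_of_nonneg_left (rpow_self_mul_exp_neg_add_one_le hm) (by positivity)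
      _ = (((n : ℝ) + 1) / 2 + 1 / 2) * (4 / √Real.pi * ((((n : ℝ) + 1) / 2) ^ (((n : ℝ) + 1) / 2) *
          Real.exp (-(((n : ℝ) + 1) / 2)))) := by ring
      _ ≤ _ := by gcongr

/-- Cramér's inequality, with constant `1`. -/
theorem abs_hermite_le {n : ℕ} (hn : 0 < n) (y : ℝ) :
    |(Polynomial.aeval y (Polynomial.hermite n) : ℝ)| ≤ √(n ! : ℝ) * Real.exp (y ^ 2 / 4) := by
  set m : ℝ := (n : ℝ) / 2 with hm
  have hmpos : 0 < m := by positivity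
  set P := m ^ m * Real.exp (-m) with hP
  -- The line `ℝ + iy/2` balances the shift: the integrand becomes a radial function.
  have h1 : |(Polynomial.aeval y (Polynomial.hermite n) : ℝ)| ≤
      Real.exp (y ^ 2 / 4) * (2 ^ m / √(2 * Real.pi) * ∫ u, radialProfile m (y / 2) u) := by
    rw [← Real.norm_eq_abs, ← Complex.norm_real, ← integral_shiftedMoment (y / 2) y n]
    refine (norm_integral_le_integral_norm _).trans (le_of_eq ?_)
    simp only [norm_shiftedMoment]
    rw [integral_const_mul, integral_gaussianReal_eq_integral_smul one_ne_zero]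
    simp only [hm, radialProfile_eq, smul_eq_mul]
    rw [integral_const_mul]
    have e1 : ((y : ℂ) - ((y / 2 : ℝ) : ℂ)) = ((y / 2 : ℝ) : ℂ) := by
      push_cast
      ring
    have e2 : Real.exp (y ^ 2 / 4) * Real.exp (-((y / 2) ^ 2 / 2)) =
        Real.exp ((y / 2) ^ 2 / 2) := by
      rw [← Real.exp_add]
      congr 1
      ring
    rw [e1, ← e2]
    field_simp
    simp only [mul_comm Complex.I]
  refine h1.trans ?_
  rw [mul_comm]
  gcongr
  have h2 := four_div_sqrt_pi_mul_le_Gamma (n - 1)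
  have e3 : ((n - 1 : ℕ) : ℝ) + 1 = n := by exact_mod_cast Nat.sub_add_cancel hn
  rw [e3, ← hm, ← hP] at h2
  -- The duplication formula at `m + 1/2` expresses `Γ(m + 1/2) Γ(m + 1)` through `n!`.
  have hdup := Real.Gamma_mul_Gamma_add_half (m + 1 / 2)
  have e4 : 2 * (m + 1 / 2) = n + 1 := by
    rw [hm]
    ring
  have e5 : (2 : ℝ) ^ (1 - ((n : ℝ) + 1)) = ((2 ^ m) ^ 2)⁻¹ := by
    rw [← Real.rpow_natCast, ← Real.rpow_mul two_pos.le, ← Real.rpow_neg two_pos.le]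
    congr 1
    rw [hm]
    push_cast
    ring
  rw [e4, add_assoc, add_halves, Real.Gamma_nat_eq_factorial, e5] at hdup
  have hG : 0 < Real.Gamma (m + 1) := Real.Gamma_pos_of_pos (by positivity)
  have h3 : 4 / √Real.pi * P * Real.Gamma (m + 1) ≤ (n ! : ℝ) * ((2 ^ m) ^ 2)⁻¹ * √Real.pi := by
    rw [← hdup]
    gcongr
  calc 2 ^ m / √(2 * Real.pi) * ∫ u, radialProfile m (y / 2) u
      ≤ 2 ^ m / √(2 * Real.pi) * (2 * √(2 * P * Real.Gamma (m + 1))) := by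
        gcongr
        exact integral_radialProfile_le hn _
    _ ≤ √(n ! : ℝ) := by
        refine Real.le_sqrt_of_sq_le ?_
        rw [mul_pow, div_pow, mul_pow, Real.sq_sqrt (by positivity), Real.sq_sqrt (by positivity)]
        have hsp : √Real.pi ^ 2 = Real.pi := Real.sq_sqrt Real.pi_pos.le
        have h4 := mul_le_mul_of_nonneg_left h3 (show 0 ≤ (2 ^ m) ^ 2 / √Real.pi by positivity)
        calc _ = (2 ^ m) ^ 2 / √Real.pi * (4 / √Real.pi * P * Real.Gamma (m + 1)) := by
              field_simp
              rw [hsp]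
              ring
          _ ≤ _ := h4
          _ = _ := by field_simp

/-! ### Mehler's formula -/

theorem integrable_exp_mul_sq {r : ℝ} (hr : r < 1) :
    Integrable (fun u : ℝ => Real.exp (r * u ^ 2 / 2)) (gaussianReal 0 1) := by
  rw [integrable_gaussianReal_iff]
  have h := (integrable_exp_neg_mul_sq (b := (1 - r) / 2) (by linarith)).const_mul
    (√(2 * Real.pi))⁻¹
  refine h.congr (Filter.Eventually.of_forall fun u => ?_)
  simp only [gaussianPDFReal, smul_eq_mul, NNReal.coe_one, mul_one, sub_zero]
  rw [mul_assoc, ← Real.exp_add]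
  congr 2
  ring

theorem integral_cexp_gaussianReal (w y : ℂ) :
    ∫ u : ℝ, Complex.exp (w * (y + u * Complex.I)) ∂(gaussianReal 0 1) =
      Complex.exp (w * y - w ^ 2 / 2) := by
  have h := complexMGF_id_gaussianReal (μ := 0) (v := 1) (w * Complex.I)
  simp only [complexMGF, id] at h
  have e : ∀ u : ℝ, w * (y + u * Complex.I) = w * y + w * Complex.I * u := fun u => by ring
  simp only [e, Complex.exp_add]
  rw [integral_const_mul, h, ← Complex.exp_add]
  congr 1
  push_cast
  linear_combination w ^ 2 / 2 * Complex.I_sq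

theorem integral_cexp_sub_sq_gaussianReal {r : ℝ} (h0 : 0 ≤ r) (h1 : r < 1) (x y : ℝ) :
    ∫ u : ℝ, Complex.exp (r * (x + u * Complex.I) * y - (r * (x + u * Complex.I)) ^ 2 / 2)
        ∂(gaussianReal 0 1) =
      (((√(1 - r ^ 2))⁻¹ *
        Real.exp ((2 * r * x * y - r ^ 2 * (x ^ 2 + y ^ 2)) / (2 * (1 - r ^ 2))) : ℝ) : ℂ) := by
  have hr : 0 < 1 - r ^ 2 := by nlinarith
  rw [integral_gaussianReal_eq_integral_smul one_ne_zero]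
  set b : ℂ := ((-((1 - r ^ 2) / 2) : ℝ) : ℂ) with hb
  set c : ℂ := (r * y - r ^ 2 * x) * Complex.I with hc
  set d : ℂ := r * x * y - r ^ 2 * x ^ 2 / 2 with hd
  have hbre : b.re < 0 := by
    rw [hb, Complex.ofReal_re]
    linarith
  have e : ∀ u : ℝ, gaussianPDFReal 0 1 u •
      Complex.exp (r * (x + u * Complex.I) * y - (r * (x + u * Complex.I)) ^ 2 / 2) =
      (((√(2 * Real.pi))⁻¹ : ℝ) : ℂ) * Complex.exp (b * u ^ 2 + c * u + d) := by
    intro u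
    rw [gaussianPDFReal, Complex.real_smul, Complex.ofReal_mul, Complex.ofReal_exp, mul_assoc,
      ← Complex.exp_add, NNReal.coe_one, mul_one]
    congr 2
    rw [hb, hc, hd]
    push_cast
    linear_combination (-(r : ℂ) ^ 2 * u ^ 2 / 2) * Complex.I_sq
  simp only [e]
  rw [integral_const_mul, integral_cexp_quadratic hbre]
  have e1 : (Real.pi : ℂ) / -b = ((2 * Real.pi / (1 - r ^ 2) : ℝ) : ℂ) := by
    rw [hb]
    push_cast
    have : (1 : ℂ) - r ^ 2 ≠ 0 := by exact_mod_cast hr.ne'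
    field_simp
  have e2 : d - c ^ 2 / (4 * b) =
      (((2 * r * x * y - r ^ 2 * (x ^ 2 + y ^ 2)) / (2 * (1 - r ^ 2)) : ℝ) : ℂ) := by
    rw [hb, hc, hd]
    push_cast
    have : (1 : ℂ) - r ^ 2 ≠ 0 := by exact_mod_cast hr.ne'
    rw [mul_pow, Complex.I_sq]
    field_simp
    ring
  rw [e1, e2, show (1 / 2 : ℂ) = ((1 / 2 : ℝ) : ℂ) by push_cast; rfl,
    ← Complex.ofReal_cpow (by positivity), ← Real.sqrt_eq_rpow, ← Complex.ofReal_exp,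
    ← Complex.ofReal_mul, ← Complex.ofReal_mul, Real.sqrt_div (by positivity)]
  congr 1
  have : 0 < √(2 * Real.pi) := by positivity
  field_simp

/-- Mehler's formula. Writing both Hermite polynomials as Gaussian moments turns the series into the
double Gaussian integral of `exp (r (x + iu) (y + iv))`. -/
theorem hasSum_hermite_mul_hermite {r : ℝ} (h0 : 0 ≤ r) (h1 : r < 1) (x y : ℝ) :
    HasSum (fun n : ℕ => r ^ n / n ! * (Polynomial.aeval x (Polynomial.hermite n) : ℝ) *
        (Polynomial.aeval y (Polynomial.hermite n) : ℝ))
      ((√(1 - r ^ 2))⁻¹ *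
        Real.exp ((2 * r * x * y - r ^ 2 * (x ^ 2 + y ^ 2)) / (2 * (1 - r ^ 2)))) := by
  rw [← Complex.hasSum_ofReal]
  set γ := gaussianReal 0 1 with hγ
  let F : ℕ → ℝ × ℝ → ℂ := fun n z =>
    (r ^ n / n ! * (x + z.1 * Complex.I) ^ n) * (y + z.2 * Complex.I) ^ n
  let f : ℝ × ℝ → ℂ := fun z => Complex.exp (r * (x + z.1 * Complex.I) * (y + z.2 * Complex.I))
  have hFsum : ∀ z, HasSum (fun n => F n z) (f z) := by
    intro z
    have h := (Complex.exp_eq_exp_ℂ ▸ NormedSpace.expSeries_div_hasSum_exp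
      ((r : ℂ) * (x + z.1 * Complex.I) * (y + z.2 * Complex.I)) : HasSum _ (f z))
    convert! h using 2 with n
    simp only [F, mul_pow]
    ring
  have hbsum : ∀ z, HasSum (fun n => ‖F n z‖)
      (Real.exp (r * ‖(x : ℂ) + z.1 * Complex.I‖ * ‖(y : ℂ) + z.2 * Complex.I‖)) := by
    intro z
    have h := (Real.exp_eq_exp_ℝ ▸ NormedSpace.expSeries_div_hasSum_exp
      (r * ‖(x : ℂ) + z.1 * Complex.I‖ * ‖(y : ℂ) + z.2 * Complex.I‖) : HasSum _ (Real.exp _))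
    convert! h using 2 with n
    simp only [F, mul_pow, norm_mul, norm_div, norm_pow, Complex.norm_real, Complex.norm_natCast,
      Real.norm_of_nonneg h0]
    ring
  have hbound : Integrable (fun z : ℝ × ℝ =>
      Real.exp (r * ‖(x : ℂ) + z.1 * Complex.I‖ * ‖(y : ℂ) + z.2 * Complex.I‖)) (γ.prod γ) := by
    have hi := ((integrable_exp_mul_sq h1).mul_prod (integrable_exp_mul_sq h1)).const_mul
      (Real.exp (r * (x ^ 2 + y ^ 2) / 2))
    refine hi.mono' (by fun_prop) (Filter.Eventually.of_forall fun z => ?_)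
    rw [Real.norm_of_nonneg (Real.exp_pos _).le, ← Real.exp_add, ← Real.exp_add, Real.exp_le_exp]
    have h2 := two_mul_le_add_sq ‖(x : ℂ) + z.1 * Complex.I‖ ‖(y : ℂ) + z.2 * Complex.I‖
    rw [← Complex.normSq_eq_norm_sq, ← Complex.normSq_eq_norm_sq, Complex.normSq_add_mul_I,
      Complex.normSq_add_mul_I] at h2
    nlinarith [mul_le_mul_of_nonneg_left h2 h0]
  have hf : Integrable f (γ.prod γ) := by
    refine hbound.mono' (by fun_prop) (Filter.Eventually.of_forall fun z => ?_)
    rw [← (hFsum z).tsum_eq, ← (hbsum z).tsum_eq]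
    exact norm_tsum_le_tsum_norm (hbsum z).summable
  have key : HasSum (fun n => ∫ z, F n z ∂(γ.prod γ)) (∫ z, f z ∂(γ.prod γ)) := by
    refine hasSum_integral_of_dominated_convergence (fun n z => ‖F n z‖)
      (fun n => by fun_prop) (fun n => Filter.Eventually.of_forall fun z => le_rfl)
      (Filter.Eventually.of_forall fun z => (hbsum z).summable) ?_
      (Filter.Eventually.of_forall hFsum)
    simpa only [(hbsum _).tsum_eq] using hbound
  have hmom : ∀ (t : ℝ) (n : ℕ), ∫ u : ℝ, ((t : ℂ) + u * Complex.I) ^ n ∂γ =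
      ((Polynomial.aeval t (Polynomial.hermite n) : ℝ) : ℂ) := by
    intro t n
    rw [← integral_shiftedMoment 0 t n]
    simp [shiftedMoment, hγ]
  convert! key using 1
  · funext n
    simp only [F]
    rw [integral_prod_mul (fun u : ℝ => (r : ℂ) ^ n / n ! * ((x : ℂ) + u * Complex.I) ^ n)
      (fun v : ℝ => ((y : ℂ) + v * Complex.I) ^ n), integral_const_mul, hmom, hmom]
    push_cast
    rfl
  · rw [integral_prod _ hf, ← integral_cexp_sub_sq_gaussianReal h0 h1]
    simp only [f, integral_cexp_gaussianReal, hγ]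

/-! ### The norm of Hermite polynomials in the Gaussian `L²` space -/

theorem integrable_aeval_gaussianReal (p : Polynomial ℤ) :
    Integrable (fun u : ℝ => (Polynomial.aeval u p : ℝ)) (gaussianReal 0 1) := by
  simp only [Polynomial.aeval_eq_sum_range]
  refine integrable_finsetSum _ fun n _ => ?_
  simp only [zsmul_eq_mul]
  refine Integrable.const_mul ?_ _
  refine (integrable_norm_add_mul_I_pow 0 n).mono' (by fun_prop)
    (Filter.Eventually.of_forall fun u => ?_)
  simp

theorem integral_hermite_sq (n : ℕ) :
    ∫ u, (Polynomial.aeval u (Polynomial.hermite n) : ℝ) ^ 2 ∂(gaussianReal 0 1) = n ! := by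
  induction n with
  | zero => simp
  | succ n ih =>
    have hd : ∀ u : ℝ, HasDerivAt (fun u : ℝ => (Polynomial.aeval u
        (Polynomial.hermite n * Polynomial.hermite (n + 1)) : ℝ))
        (Polynomial.aeval u (Polynomial.derivative
          (Polynomial.hermite n * Polynomial.hermite (n + 1)))) u :=
      fun u => Polynomial.hasDerivAt_aeval _ u
    have hX : (fun u : ℝ => u • (Polynomial.aeval u
        (Polynomial.hermite n * Polynomial.hermite (n + 1)) : ℝ)) = fun u : ℝ => (Polynomial.aeval u
        (Polynomial.X * (Polynomial.hermite n * Polynomial.hermite (n + 1))) : ℝ) := by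
      funext u
      simp
    have h := integral_deriv_gaussianReal hd (integrable_aeval_gaussianReal _)
      (integrable_aeval_gaussianReal _) (by rw [hX]; exact integrable_aeval_gaussianReal _)
    rw [hX, ← sub_eq_zero, ← integral_sub (integrable_aeval_gaussianReal _)
      (integrable_aeval_gaussianReal _)] at h
    have e : ∀ u : ℝ, (Polynomial.aeval u (Polynomial.derivative
          (Polynomial.hermite n * Polynomial.hermite (n + 1))) : ℝ) - Polynomial.aeval u
        (Polynomial.X * (Polynomial.hermite n * Polynomial.hermite (n + 1))) =
        (n + 1) * (Polynomial.aeval u (Polynomial.hermite n ^ 2) : ℝ) -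
          Polynomial.aeval u (Polynomial.hermite (n + 1) ^ 2) := by
      intro u
      rw [Polynomial.derivative_mul, derivative_hermite_succ]
      have h2 : (Polynomial.aeval u (Polynomial.hermite (n + 1)) : ℝ) =
          u * Polynomial.aeval u (Polynomial.hermite n) -
            Polynomial.aeval u (Polynomial.derivative (Polynomial.hermite n)) := by
        rw [Polynomial.hermite_succ]
        simp
      simp only [map_add, map_mul, map_natCast, map_one, map_pow, Polynomial.aeval_X]
      rw [h2]
      ring
    simp only [e] at h
    rw [integral_sub ((integrable_aeval_gaussianReal _).const_mul _)
      (integrable_aeval_gaussianReal _), integral_const_mul, sub_eq_zero] at h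
    simp only [map_pow] at h
    rw [← h, ih, Nat.factorial_succ]
    push_cast
    rfl

/-! ### The parameters and the Mercer expansion -/

theorem beta_pos {ℓ : ℝ} : 0 < beta (1 / √2) ℓ := by
  unfold beta
  positivity

theorem beta_pow_four {ℓ : ℝ} (hℓ : 0 < ℓ) : beta (1 / √2) ℓ ^ 4 = 1 + 4 / ℓ ^ 2 := by
  have h2 : √2 ^ 2 = (2 : ℝ) := Real.sq_sqrt two_pos.le
  rw [beta, ← Real.rpow_natCast, ← Real.rpow_mul (by positivity)]
  norm_num [epsilon]
  field_simp
  norm_num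

theorem one_lt_beta {ℓ : ℝ} (hℓ : 0 < ℓ) : 1 < beta (1 / √2) ℓ := by
  refine lt_of_pow_lt_pow_left₀ 4 beta_pos.le ?_
  rw [beta_pow_four hℓ, one_pow]
  have : 0 < 4 / ℓ ^ 2 := by positivity
  linarith

theorem deltaSq_eq (ℓ : ℝ) : deltaSq (1 / √2) ℓ = (beta (1 / √2) ℓ ^ 2 - 1) / 4 := by
  rw [deltaSq, div_pow, Real.sq_sqrt two_pos.le]
  ring

theorem epsilon_sq {ℓ : ℝ} (hℓ : 0 < ℓ) : epsilon ℓ ^ 2 = (beta (1 / √2) ℓ ^ 4 - 1) / 8 := by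
  rw [beta_pow_four hℓ, epsilon, div_pow, mul_pow, Real.sq_sqrt two_pos.le]
  field_simp
  ring

theorem eigenvalue_denominator {ℓ : ℝ} (hℓ : 0 < ℓ) :
    (1 / √2) ^ 2 + deltaSq (1 / √2) ℓ + epsilon ℓ ^ 2 = (beta (1 / √2) ℓ ^ 2 + 1) ^ 2 / 8 := by
  rw [deltaSq_eq, epsilon_sq hℓ, div_pow, Real.sq_sqrt two_pos.le]
  ring

theorem eigenvalueRatio_eq {ℓ : ℝ} (hℓ : 0 < ℓ) : eigenvalueRatio (1 / √2) ℓ =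
    (beta (1 / √2) ℓ ^ 2 - 1) / (beta (1 / √2) ℓ ^ 2 + 1) := by
  rw [eigenvalueRatio, eigenvalue_denominator hℓ, epsilon_sq hℓ]
  field_simp
  ring

theorem eigenvaluePrefactor_eq {ℓ : ℝ} (hℓ : 0 < ℓ) : eigenvaluePrefactor (1 / √2) ℓ =
    2 / (beta (1 / √2) ℓ ^ 2 + 1) := by
  rw [eigenvaluePrefactor, eigenvalue_denominator hℓ, Real.sqrt_eq_iff_mul_self_eq (by positivity)
    (by positivity), div_pow, Real.sq_sqrt two_pos.le]
  field_simp
  norm_num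

/-- The Mercer eigenvalues `τ λⁿ` sum to `1`. -/
theorem eigenvaluePrefactor_eq_one_sub {ℓ : ℝ} (hℓ : 0 < ℓ) :
    eigenvaluePrefactor (1 / √2) ℓ = 1 - eigenvalueRatio (1 / √2) ℓ := by
  rw [eigenvaluePrefactor_eq hℓ, eigenvalueRatio_eq hℓ]
  field_simp
  ring

theorem eigenvalueRatio_pos {ℓ : ℝ} (hℓ : 0 < ℓ) : 0 < eigenvalueRatio (1 / √2) ℓ := by
  rw [eigenvalueRatio_eq hℓ]
  have := one_lt_beta hℓ
  exact div_pos (by nlinarith) (by positivity)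

theorem eigenvaluePrefactor_pos {ℓ : ℝ} (hℓ : 0 < ℓ) : 0 < eigenvaluePrefactor (1 / √2) ℓ := by
  rw [eigenvaluePrefactor_eq hℓ]
  positivity

theorem eigenvalueRatio_lt_one {ℓ : ℝ} (hℓ : 0 < ℓ) : eigenvalueRatio (1 / √2) ℓ < 1 := by
  linarith [eigenvaluePrefactor_pos hℓ, eigenvaluePrefactor_eq_one_sub hℓ]

theorem eigenfunction_eq (ℓ : ℝ) (n : ℕ) (x : ℝ) : eigenfunction (1 / √2) ℓ n x =
    √(beta (1 / √2) ℓ / n !) * Real.exp (-((beta (1 / √2) ℓ ^ 2 - 1) / 4) * x ^ 2) *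
      Polynomial.aeval (beta (1 / √2) ℓ * x) (Polynomial.hermite n) := by
  rw [eigenfunction, deltaSq_eq, mul_one_div_cancel (by positivity), one_mul]

/-- The Mercer expansion of the Gaussian kernel: Mehler's formula at `(βx, βy)` with `r = λ`. -/
theorem hasSum_mercer {ℓ : ℝ} (hℓ : 0 < ℓ) (x y : ℝ) :
    HasSum (fun n : ℕ => eigenvaluePrefactor (1 / √2) ℓ * eigenvalueRatio (1 / √2) ℓ ^ n *
        (eigenfunction (1 / √2) ℓ n x * eigenfunction (1 / √2) ℓ n y))
      (gaussianKernel ℓ x y) := by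
  have hβ := one_lt_beta hℓ
  have hM := hasSum_hermite_mul_hermite (eigenvalueRatio_pos hℓ).le (eigenvalueRatio_lt_one hℓ)
    (beta (1 / √2) ℓ * x) (beta (1 / √2) ℓ * y)
  have h := hM.mul_left (eigenvaluePrefactor (1 / √2) ℓ * beta (1 / √2) ℓ *
    Real.exp (-((beta (1 / √2) ℓ ^ 2 - 1) / 4) * (x ^ 2 + y ^ 2)))
  convert! h using 1
  · funext n
    rw [eigenfunction_eq, eigenfunction_eq, mul_add, Real.exp_add]
    have hs : √(beta (1 / √2) ℓ / n !) * √(beta (1 / √2) ℓ / n !) = beta (1 / √2) ℓ / n ! :=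
      Real.mul_self_sqrt (div_nonneg beta_pos.le (by positivity))
    linear_combination (eigenvaluePrefactor (1 / √2) ℓ * eigenvalueRatio (1 / √2) ℓ ^ n *
      Real.exp (-((beta (1 / √2) ℓ ^ 2 - 1) / 4) * x ^ 2) *
      (Polynomial.aeval (beta (1 / √2) ℓ * x) (Polynomial.hermite n) : ℝ) *
      (Real.exp (-((beta (1 / √2) ℓ ^ 2 - 1) / 4) * y ^ 2) *
      (Polynomial.aeval (beta (1 / √2) ℓ * y) (Polynomial.hermite n) : ℝ))) * hs
  · have h4 := beta_pow_four hℓ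
    rw [eigenvaluePrefactor_eq hℓ, eigenvalueRatio_eq hℓ]
    set β := beta (1 / √2) ℓ
    have hβ0 : 0 < β := by linarith
    have e1 : 1 - ((β ^ 2 - 1) / (β ^ 2 + 1)) ^ 2 = (2 * β / (β ^ 2 + 1)) ^ 2 := by
      field_simp
      ring
    have e2 : (β ^ 2 - 1) * (β ^ 2 + 1) = 4 / ℓ ^ 2 := by linear_combination h4
    rw [e1, Real.sqrt_sq (by positivity)]
    have e3 : ∀ X Y : ℝ, 2 / (β ^ 2 + 1) * β * X * ((2 * β / (β ^ 2 + 1))⁻¹ * Y) = X * Y :=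
      fun X Y => by field_simp
    rw [e3, ← Real.exp_add, gaussianKernel]
    congr 1
    have e4 : -(x - y) ^ 2 / (2 * ℓ ^ 2) = -(x - y) ^ 2 / 8 * (4 / ℓ ^ 2) := by
      field_simp
      ring
    rw [e4, ← e2]
    field_simp
    ring

/-! ### Bounds on the eigenfunctions -/

theorem abs_eigenfunction_le {ℓ : ℝ} {n : ℕ} (hn : 0 < n) (x : ℝ) :
    |eigenfunction (1 / √2) ℓ n x| ≤ √(beta (1 / √2) ℓ) * Real.exp (x ^ 2 / 4) := by
  rw [eigenfunction_eq, abs_mul, abs_of_nonneg (by positivity), Real.sqrt_div' _ (by positivity)]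
  set β := beta (1 / √2) ℓ
  calc _ ≤ √β / √(n ! : ℝ) * Real.exp (-((β ^ 2 - 1) / 4) * x ^ 2) *
        (√(n ! : ℝ) * Real.exp ((β * x) ^ 2 / 4)) := by
        gcongr
        exact abs_hermite_le hn _
    _ = √β * (Real.exp (-((β ^ 2 - 1) / 4) * x ^ 2) * Real.exp ((β * x) ^ 2 / 4)) := by
        field_simp
    _ = _ := by
        rw [← Real.exp_add]
        congr 2
        ring

/-- The Gaussian factor of `φₙ²` turns the standard Gaussian density into the density at `βu`. -/
theorem gaussianPDFReal_smul_eigenfunction_sq (ℓ : ℝ) (n : ℕ) (u : ℝ) :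
    gaussianPDFReal 0 1 u • eigenfunction (1 / √2) ℓ n u ^ 2 =
      beta (1 / √2) ℓ / n ! * (gaussianPDFReal 0 1 (beta (1 / √2) ℓ * u) •
        (Polynomial.aeval (beta (1 / √2) ℓ * u) (Polynomial.hermite n) : ℝ) ^ 2) := by
  rw [eigenfunction_eq, mul_pow, mul_pow, Real.sq_sqrt (div_nonneg beta_pos.le (by positivity)),
    ← Real.exp_nat_mul]
  set β := beta (1 / √2) ℓ
  have e : Real.exp (-(β * u - 0) ^ 2 / (2 * ((1 : NNReal) : ℝ))) =
      Real.exp (-(u - 0) ^ 2 / (2 * ((1 : NNReal) : ℝ))) *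
        Real.exp ((2 : ℕ) * (-((β ^ 2 - 1) / 4) * u ^ 2)) := by
    rw [← Real.exp_add]
    congr 1
    push_cast
    ring
  simp only [gaussianPDFReal, smul_eq_mul]
  rw [e]
  ring

theorem integrable_eigenfunction_sq (ℓ : ℝ) (n : ℕ) :
    Integrable (fun u => eigenfunction (1 / √2) ℓ n u ^ 2) (gaussianReal 0 1) := by
  rw [integrable_gaussianReal_iff]
  simp only [gaussianPDFReal_smul_eigenfunction_sq]
  have h := integrable_gaussianReal_iff.1 (integrable_aeval_gaussianReal (Polynomial.hermite n ^ 2))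
  simp only [map_pow] at h
  exact (h.comp_mul_left' beta_pos.ne').const_mul _

theorem integral_eigenfunction_sq (ℓ : ℝ) (n : ℕ) :
    ∫ u, eigenfunction (1 / √2) ℓ n u ^ 2 ∂(gaussianReal 0 1) = 1 := by
  rw [integral_gaussianReal_eq_integral_smul one_ne_zero]
  simp only [gaussianPDFReal_smul_eigenfunction_sq]
  rw [integral_const_mul, Measure.integral_comp_mul_left (fun t : ℝ => gaussianPDFReal 0 1 t •
        (Polynomial.aeval t (Polynomial.hermite n) : ℝ) ^ 2),
    ← integral_gaussianReal_eq_integral_smul one_ne_zero, integral_hermite_sq,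
    abs_of_pos (inv_pos.2 beta_pos), smul_eq_mul]
  have := beta_pos (ℓ := ℓ)
  field_simp

/-- Since `φₙ` has unit norm in `L²(μ)` and `|φₙ| ≤ (φₙ² + 1) / 2`. -/
theorem abs_gaussianIntegral_eigenfunction_le (ℓ : ℝ) (n : ℕ) :
    |gaussianIntegral (eigenfunction (1 / √2) ℓ n)| ≤ 1 := by
  have hi := integrable_eigenfunction_sq ℓ n
  have hb : ∀ u, ‖eigenfunction (1 / √2) ℓ n u‖ ≤ (eigenfunction (1 / √2) ℓ n u ^ 2 + 1) / 2 := by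
    intro u
    rw [Real.norm_eq_abs, ← sq_abs]
    nlinarith [sq_nonneg (|eigenfunction (1 / √2) ℓ n u| - 1)]
  have hg : Integrable (fun u => (eigenfunction (1 / √2) ℓ n u ^ 2 + 1) / 2) (gaussianReal 0 1) :=
    (hi.add (integrable_const 1)).div_const 2
  calc _ ≤ ∫ u, (eigenfunction (1 / √2) ℓ n u ^ 2 + 1) / 2 ∂(gaussianReal 0 1) :=
        norm_integral_le_of_norm_le hg (Filter.Eventually.of_forall hb)
    _ = 1 := by
        rw [integral_div, integral_add hi (integrable_const 1), integral_eigenfunction_sq]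
        simp

/-! ### Representers of the error functional -/

section FeatureMap

variable {H : Type*} [NormedAddCommGroup H] [InnerProductSpace ℝ H]

theorem norm_feature {ℓ : ℝ} {e : ℝ → H}
    (he : ∀ x y, inner ℝ (e x) (e y) = gaussianKernel ℓ x y) (x : ℝ) : ‖e x‖ = 1 := by
  have h := real_inner_self_eq_norm_sq (e x)
  rw [he] at h
  simp only [gaussianKernel, sub_self, ne_eq, OfNat.ofNat_ne_zero, not_false_eq_true, zero_pow,
    neg_zero, zero_div, Real.exp_zero] at h
  nlinarith [norm_nonneg (e x)]

theorem continuous_feature {ℓ : ℝ} {e : ℝ → H}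
    (he : ∀ x y, inner ℝ (e x) (e y) = gaussianKernel ℓ x y) : Continuous e := by
  have hd : ∀ x y : ℝ, dist (e x) (e y) = √(2 - 2 * gaussianKernel ℓ x y) := by
    intro x y
    rw [dist_eq_norm, ← Real.sqrt_sq (norm_nonneg (e x - e y)), norm_sub_sq_real,
      norm_feature he, norm_feature he, he]
    congr 1
    ring
  rw [continuous_iff_continuousAt]
  intro x
  rw [ContinuousAt, tendsto_iff_dist_tendsto_zero]
  simp only [hd]
  have h : Continuous fun y : ℝ => √(2 - 2 * gaussianKernel ℓ y x) := by
    unfold gaussianKernel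
    fun_prop
  simpa [gaussianKernel] using h.tendsto x

theorem integrable_feature [CompleteSpace H] {ℓ : ℝ} {e : ℝ → H}
    (he : ∀ x y, inner ℝ (e x) (e y) = gaussianKernel ℓ x y) :
    Integrable e (gaussianReal 0 1) :=
  Integrable.of_bound (continuous_feature he).aestronglyMeasurable 1
    (Filter.Eventually.of_forall fun x => (norm_feature he x).le)

/-- The error functional `f ↦ μ(f) - Q(f)` of a quadrature rule. -/
noncomputable def quadratureError {N : ℕ} (x w : Fin N → ℝ) (f : ℝ → ℝ) : ℝ :=
  gaussianIntegral f - quadrature x w f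

/-- The representer `∫ e dμ - ∑ wₙ e(xₙ)` of the error functional under a feature map `e`. -/
noncomputable def errorRepresenter {N : ℕ} (x w : Fin N → ℝ) (e : ℝ → H) : H :=
  ∫ t, e t ∂(gaussianReal 0 1) - ∑ n, w n • e (x n)

theorem inner_errorRepresenter [CompleteSpace H] {N : ℕ} (x w : Fin N → ℝ) {e : ℝ → H}
    (hi : Integrable e (gaussianReal 0 1)) (v : H) :
    inner ℝ v (errorRepresenter x w e) = quadratureError x w fun t => inner ℝ v (e t) := by
  rw [errorRepresenter, quadratureError, inner_sub_right, ← integral_inner hi, inner_sum]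
  simp only [inner_smul_right, gaussianIntegral, quadrature]

/-- The norm of the representer depends on the feature map only through the kernel. -/
theorem norm_sq_errorRepresenter [CompleteSpace H] {ℓ : ℝ} {N : ℕ} (x w : Fin N → ℝ) {e : ℝ → H}
    (he : ∀ x y, inner ℝ (e x) (e y) = gaussianKernel ℓ x y) :
    ‖errorRepresenter x w e‖ ^ 2 =
      quadratureError x w fun t => quadratureError x w fun s => gaussianKernel ℓ t s := by
  have hi := integrable_feature he
  rw [← real_inner_self_eq_norm_sq, inner_errorRepresenter x w hi]
  congr 1
  funext t
  rw [real_inner_comm, inner_errorRepresenter x w hi]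
  simp only [he]

end FeatureMap

theorem inner_kerFun_gaussianRKHS (ℓ x y : ℝ) :
    inner ℝ (RKHS.kerFun (GaussianRKHS ℓ) x 1) (RKHS.kerFun (GaussianRKHS ℓ) y 1) =
      gaussianKernel ℓ x y := by
  rw [RKHS.kerFun_inner, RKHS.kerFun_apply, RKHS.OfKernel.kernel_ofKernel]
  simp [gaussianKernelMatrix]

theorem abs_quadratureError_le {ℓ : ℝ} {N : ℕ} (x w : Fin N → ℝ) (f : GaussianRKHS ℓ) :
    |quadratureError x w f| ≤
      ‖f‖ * ‖errorRepresenter x w fun t => RKHS.kerFun (GaussianRKHS ℓ) t 1‖ := by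
  have hf : (f : ℝ → ℝ) = fun t => inner ℝ f (RKHS.kerFun (GaussianRKHS ℓ) t 1) := by
    funext t
    rw [RKHS.inner_kerFun]
    simp
  rw [hf, ← inner_errorRepresenter x w (integrable_feature (inner_kerFun_gaussianRKHS ℓ))]
  exact abs_real_inner_le_norm _ _

/-! ### The worst-case error in Mercer coordinates -/

/-- The Mercer feature map `x ↦ (√(τ λⁿ) φₙ(x))ₙ` into `ℓ²`. -/
noncomputable def mercerFeature {ℓ : ℝ} (hℓ : 0 < ℓ) (x : ℝ) : lp (fun _ : ℕ => ℝ) 2 :=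
  ⟨fun n => √(eigenvaluePrefactor (1 / √2) ℓ * eigenvalueRatio (1 / √2) ℓ ^ n) *
    eigenfunction (1 / √2) ℓ n x, by
    refine memℓp_gen ?_
    refine (hasSum_mercer hℓ x x).summable.congr fun n => ?_
    have h : 0 ≤ eigenvaluePrefactor (1 / √2) ℓ * eigenvalueRatio (1 / √2) ℓ ^ n :=
      mul_nonneg (eigenvaluePrefactor_pos hℓ).le (pow_nonneg (eigenvalueRatio_pos hℓ).le _)
    simp only [ENNReal.toReal_ofNat, Real.rpow_two, Real.norm_eq_abs, sq_abs]
    rw [mul_pow, Real.sq_sqrt h, sq]⟩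

theorem mercerFeature_apply {ℓ : ℝ} (hℓ : 0 < ℓ) (x : ℝ) (n : ℕ) :
    mercerFeature hℓ x n = √(eigenvaluePrefactor (1 / √2) ℓ * eigenvalueRatio (1 / √2) ℓ ^ n) *
      eigenfunction (1 / √2) ℓ n x := rfl

theorem inner_mercerFeature {ℓ : ℝ} (hℓ : 0 < ℓ) (x y : ℝ) :
    inner ℝ (mercerFeature hℓ x) (mercerFeature hℓ y) = gaussianKernel ℓ x y := by
  rw [lp.inner_eq_tsum, ← (hasSum_mercer hℓ x y).tsum_eq]
  congr 1
  funext n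
  have h : 0 ≤ eigenvaluePrefactor (1 / √2) ℓ * eigenvalueRatio (1 / √2) ℓ ^ n :=
    mul_nonneg (eigenvaluePrefactor_pos hℓ).le (pow_nonneg (eigenvalueRatio_pos hℓ).le _)
  rw [mercerFeature_apply, mercerFeature_apply, ← Real.mul_self_sqrt h]
  simp only [RCLike.inner_apply, conj_trivial, Real.sqrt_mul_self (Real.sqrt_nonneg _)]
  ring

theorem quadratureError_const_mul {N : ℕ} (x w : Fin N → ℝ) (c : ℝ) (f : ℝ → ℝ) :
    quadratureError x w (fun t => c * f t) = c * quadratureError x w f := by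
  simp only [quadratureError, gaussianIntegral, quadrature, integral_const_mul, mul_sub,
    Finset.mul_sum]
  congr 2
  funext n
  ring

theorem errorRepresenter_mercerFeature_apply {ℓ : ℝ} (hℓ : 0 < ℓ) {N : ℕ} (x w : Fin N → ℝ)
    (n : ℕ) : errorRepresenter x w (mercerFeature hℓ) n =
      √(eigenvaluePrefactor (1 / √2) ℓ * eigenvalueRatio (1 / √2) ℓ ^ n) *
        quadratureError x w (eigenfunction (1 / √2) ℓ n) := by
  have h := inner_errorRepresenter x w (integrable_feature (inner_mercerFeature hℓ))
    (lp.single 2 n (1 : ℝ))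
  simp only [lp.inner_single_left, mercerFeature_apply] at h
  simpa [quadratureError_const_mul] using h

/-- Parseval's identity for the representer in `ℓ²`. -/
theorem norm_sq_errorRepresenter_mercer {ℓ : ℝ} (hℓ : 0 < ℓ) {N : ℕ} (x w : Fin N → ℝ) :
    HasSum (fun n => eigenvaluePrefactor (1 / √2) ℓ * eigenvalueRatio (1 / √2) ℓ ^ n *
        quadratureError x w (eigenfunction (1 / √2) ℓ n) ^ 2)
      (‖errorRepresenter x w (mercerFeature hℓ)‖ ^ 2) := by
  rw [← real_inner_self_eq_norm_sq]
  convert! lp.hasSum_inner (𝕜 := ℝ) (errorRepresenter x w (mercerFeature hℓ))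
    (errorRepresenter x w (mercerFeature hℓ)) using 2 with n
  have h : 0 ≤ eigenvaluePrefactor (1 / √2) ℓ * eigenvalueRatio (1 / √2) ℓ ^ n :=
    mul_nonneg (eigenvaluePrefactor_pos hℓ).le (pow_nonneg (eigenvalueRatio_pos hℓ).le _)
  rw [errorRepresenter_mercerFeature_apply, real_inner_self_eq_norm_sq, Real.norm_eq_abs, sq_abs,
    mul_pow, Real.sq_sqrt h]

/-- The tail of the Parseval series is dominated by `A² τ ∑ₙ λⁿ`, `n ≥ M`, which equals `A² λᴹ`
because `τ = 1 - λ`. -/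
theorem norm_errorRepresenter_mercer_le {ℓ : ℝ} (hℓ : 0 < ℓ) {N : ℕ} (x w : Fin N → ℝ) {M : ℕ}
    {A : ℝ} (hA : 0 ≤ A)
    (h0 : ∀ n < M, quadratureError x w (eigenfunction (1 / √2) ℓ n) = 0)
    (hle : ∀ n, M ≤ n → |quadratureError x w (eigenfunction (1 / √2) ℓ n)| ≤ A) :
    ‖errorRepresenter x w (mercerFeature hℓ)‖ ≤ A * √(eigenvalueRatio (1 / √2) ℓ) ^ M := by
  have hs := norm_sq_errorRepresenter_mercer hℓ x w
  have hτ := eigenvaluePrefactor_eq_one_sub hℓ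
  have hτ0 := eigenvaluePrefactor_pos hℓ
  have hl0 := eigenvalueRatio_pos hℓ
  have hl1 := eigenvalueRatio_lt_one hℓ
  set τ := eigenvaluePrefactor (1 / √2) ℓ
  set l := eigenvalueRatio (1 / √2) ℓ
  refine le_of_sq_le_sq ?_ (by positivity)
  rw [mul_pow, ← pow_mul, mul_comm M, pow_mul, Real.sq_sqrt hl0.le, ← hs.tsum_eq,
    ← hs.summable.sum_add_tsum_nat_add M, Finset.sum_eq_zero, zero_add]
  · have hg : HasSum (fun k : ℕ => A ^ 2 * τ * l ^ M * l ^ k) (A ^ 2 * l ^ M) := by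
      convert! (hasSum_geometric_of_lt_one hl0.le hl1).mul_left (A ^ 2 * τ * l ^ M) using 1
      rw [← hτ]
      field_simp
    rw [← hg.tsum_eq]
    refine ((summable_nat_add_iff M).2 hs.summable).tsum_le_tsum (fun k => ?_) hg.summable
    have h1 := pow_le_pow_left₀ (abs_nonneg _) (hle (k + M) (Nat.le_add_left M k)) 2
    rw [sq_abs] at h1
    calc _ ≤ τ * l ^ (k + M) * A ^ 2 := by gcongr
      _ = _ := by ring
  · intro n hn
    rw [h0 n (Finset.mem_range.1 hn)]
    ring

theorem worstCaseError_le {ℓ : ℝ} (hℓ : 0 < ℓ) {N : ℕ} (x w : Fin N → ℝ) :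
    worstCaseError ℓ x w ≤ ENNReal.ofReal ‖errorRepresenter x w (mercerFeature hℓ)‖ := by
  refine iSup₂_le fun f hf => ENNReal.ofReal_le_ofReal ?_
  have h : ‖errorRepresenter x w fun t => RKHS.kerFun (GaussianRKHS ℓ) t 1‖ =
      ‖errorRepresenter x w (mercerFeature hℓ)‖ := by
    rw [← sq_eq_sq₀ (norm_nonneg _) (norm_nonneg _),
      norm_sq_errorRepresenter x w (inner_kerFun_gaussianRKHS ℓ),
      norm_sq_errorRepresenter x w (inner_mercerFeature hℓ)]
  rw [← h]
  exact (abs_quadratureError_le x w f).trans (mul_le_of_le_one_left (norm_nonneg _) hf)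

/-- On the range `|x| ≤ 2 √M / β` of the nodes, `e^{x²/4} ≤ e^{M/β²}`. -/
theorem abs_quadratureError_eigenfunction_le {ℓ : ℝ} {N : ℕ} {x w : Fin N → ℝ} {W : ℝ} {M n : ℕ}
    (hw : ∑ i, |w i| ≤ W) (hx : ∀ i, |x i| ≤ 2 * √(M : ℝ) / beta (1 / √2) ℓ) (hn : 0 < n) :
    |quadratureError x w (eigenfunction (1 / √2) ℓ n)| ≤
      1 + W * (√(beta (1 / √2) ℓ) * Real.exp (1 / beta (1 / √2) ℓ ^ 2) ^ M) := by
  refine (abs_sub _ _).trans (add_le_add (abs_gaussianIntegral_eigenfunction_le ℓ n) ?_)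
  refine (Finset.abs_sum_le_sum_abs _ _).trans ?_
  calc _ ≤ ∑ i, |w i| * (√(beta (1 / √2) ℓ) * Real.exp (1 / beta (1 / √2) ℓ ^ 2) ^ M) := by
        refine Finset.sum_le_sum fun i _ => ?_
        rw [abs_mul]
        refine mul_le_mul_of_nonneg_left ((abs_eigenfunction_le hn _).trans ?_) (abs_nonneg _)
        rw [← Real.exp_nat_mul]
        gcongr
        have h := pow_le_pow_left₀ (abs_nonneg _) (hx i) 2
        rw [sq_abs, div_pow, mul_pow, Real.sq_sqrt (Nat.cast_nonneg M)] at h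
        calc x i ^ 2 / 4 ≤ (2 ^ 2 * M / beta (1 / √2) ℓ ^ 2) / 4 := by gcongr
          _ = _ := by ring
    _ ≤ _ := by
        rw [← Finset.sum_mul]
        gcongr

/-! ### The constants of the error bound -/

theorem one_le_constC₂ {ℓ : ℝ} (hℓ : 0 < ℓ) : 1 ≤ constC₂ (1 / √2) ℓ := by
  have h0 := eigenvalueRatio_pos hℓ
  have h1 := eigenvalueRatio_lt_one hℓ
  have hs : √(eigenvalueRatio (1 / √2) ℓ) < 1 := by
    rw [Real.sqrt_lt' one_pos]
    simpa using h1
  rw [constC₂, eigenvaluePrefactor_eq_one_sub hℓ, one_le_div (by linarith)]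
  refine Real.le_sqrt_of_sq_le ?_
  nlinarith [Real.sq_sqrt h0.le, Real.sqrt_nonneg (eigenvalueRatio (1 / √2) ℓ)]

/-- The inequality `s < artanh s`, in exponential form. -/
theorem exp_two_mul_lt {s : ℝ} (h0 : 0 < s) (h1 : s < 1) :
    (1 - s) * Real.exp (2 * s) < 1 + s := by
  have hsum := Real.hasSum_log_sub_log_of_abs_lt_one (abs_lt.2 ⟨by linarith, h1⟩)
  have h := hsum.summable.sum_le_tsum (Finset.range 2) fun k _ => by positivity
  rw [hsum.tsum_eq] at h
  have hlt : 2 * s < Real.log (1 + s) - Real.log (1 - s) := by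
    refine lt_of_lt_of_le ?_ h
    simp only [Finset.sum_range_succ, Finset.sum_range_zero]
    have : 0 < s ^ 3 := by positivity
    norm_num
    linarith
  rw [← Real.log_div (by linarith) (by linarith), Real.lt_log_iff_exp_lt
    (div_pos (by linarith) (by linarith)), lt_div_iff₀ (by linarith)] at hlt
  linarith

/-- With `s = 1 / β²` one has `λ = (1 - s) / (1 + s)`, and the claim is `exp_two_mul_lt`. -/
theorem rate_lt_one {ℓ : ℝ} (hℓ : 0 < ℓ) : rate (1 / √2) ℓ < 1 := by
  have hβ := one_lt_beta hℓ
  have h := exp_two_mul_lt (s := 1 / beta (1 / √2) ℓ ^ 2) (by positivity)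
    ((div_lt_one (by positivity)).2 (by nlinarith))
  refine lt_of_pow_lt_pow_left₀ 2 zero_le_one ?_
  rw [rate, mul_pow, Real.sq_sqrt (eigenvalueRatio_pos hℓ).le, ← Real.exp_nat_mul, one_pow,
    eigenvalueRatio_eq hℓ, div_mul_eq_mul_div, div_lt_one (by positivity)]
  have h2 := mul_lt_mul_of_pos_left h (show 0 < beta (1 / √2) ℓ ^ 2 by positivity)
  calc _ = beta (1 / √2) ℓ ^ 2 * ((1 - 1 / beta (1 / √2) ℓ ^ 2) *
        Real.exp (2 * (1 / beta (1 / √2) ℓ ^ 2))) := by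
        push_cast
        field_simp
    _ < _ := h2
    _ = _ := by field_simp

end GaussianQuadrature

theorem mainTheorem2 :
    ∃ K : ℝ, 0 < K ∧ K ≤ 1.087 ∧
      ∀ (α : ℝ), α = 1 / √2 → ∀ (ℓ : ℝ), 0 < ℓ →
        0 < GaussianQuadrature.constC₁ K α ℓ ∧
        0 < GaussianQuadrature.constC₂ α ℓ ∧
        0 < GaussianQuadrature.rate α ℓ ∧
        GaussianQuadrature.rate α ℓ < 1 ∧
        ∀ (N : ℕ) (x w : Fin N → ℝ) (W : ℝ) (M : ℕ), 0 ≤ W → 1 ≤ M →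
          ∑ n, |w n| ≤ W →
          (∀ n < M,
            GaussianQuadrature.quadrature x w (GaussianQuadrature.eigenfunction α ℓ n) =
              GaussianQuadrature.gaussianIntegral (GaussianQuadrature.eigenfunction α ℓ n)) →
          (∀ n, |x n| ≤ 2 * √(M : ℝ) / GaussianQuadrature.beta α ℓ) →
          GaussianQuadrature.worstCaseError ℓ x w ≤
            ENNReal.ofReal ((1 + GaussianQuadrature.constC₁ K α ℓ * W) *
              GaussianQuadrature.constC₂ α ℓ * GaussianQuadrature.rate α ℓ ^ M) := by
  open GaussianQuadrature in
  refine ⟨1, one_pos, by norm_num, ?_⟩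
  rintro _ rfl ℓ hℓ
  have hβ := beta_pos (ℓ := ℓ)
  have hl := eigenvalueRatio_pos hℓ
  have hC₂ := one_le_constC₂ hℓ
  refine ⟨by rw [constC₁]; positivity, by linarith, by rw [rate]; positivity, rate_lt_one hℓ, ?_⟩
  intro N x w W M hW hM hw hQ hx
  refine (worstCaseError_le hℓ x w).trans (ENNReal.ofReal_le_ofReal ?_)
  refine (norm_errorRepresenter_mercer_le hℓ x w (by positivity)
    (fun n hn => by rw [quadratureError, hQ n hn, sub_self])
    (fun n hn => abs_quadratureError_eigenfunction_le hw hx (hM.trans hn))).trans ?_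
  rw [rate, mul_pow, constC₁, one_mul]
  set E := Real.exp (1 / GaussianQuadrature.beta (1 / √2) ℓ ^ 2) ^ M
  have hE : 1 ≤ E := one_le_pow₀ (Real.one_le_exp (by positivity))
  set L := √(eigenvalueRatio (1 / √2) ℓ) ^ M
  have hL : 0 ≤ L := by positivity
  calc (1 + W * (√(GaussianQuadrature.beta (1 / √2) ℓ) * E)) * L
      ≤ (E + W * (√(GaussianQuadrature.beta (1 / √2) ℓ) * E)) * L := by gcongr
    _ = (1 + √(GaussianQuadrature.beta (1 / √2) ℓ) * W) * 1 * (L * E) := by ring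
    _ ≤ _ := by gcongr
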